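/- Let $N\in\mathbb N$, let $X$ be a (real or complex) Banach space, and let $p\in\{0,1,\infty\}$. Let $\mathbf X=l^p(\mathbb Z^N,X)$ be the space of sequences $x=(x_i)_{i\in\mathbb Z^N}$ in $X$ with the usual $p$-norm, where $l^0(\mathbb Z^N,X)$ denotes the closure in $l^\infty(\mathbb Z^N,X)$ of the finitely supported sequences. Let $P_n$ be the operator of multiplication by the characteristic function of $\{-n,\dots,n\}^N$ and let $V_\alpha$ be the shift $(V_\alpha x)_i=x_{i-\alpha}$ on $\mathbf X$. A bounded linear operator $K$ on $\mathbf X$ is called $\mathcal P$-compact if $\|(I-P_n)K\|+\|K(I-P_n)\|\to0$ as $n\to\infty$; $\mathcal L(\mathbf X,\mathcal P)$ is the set of all bounded linear operators $A$ on $\mathbf X$ such that $AK$ and $KA$ are $\mathcal P$-compact for every $\mathcal P$-compact $K$. A bounded sequence $(A_n)$ in $\mathcal L(\mathbf X,\mathcal P)$ converges $\mathcal P$-strongly to a bounded linear operator $B$ if $\|P_m(A_n-B)\|+\|(A_n-B)P_m\|\to0$ as $n\to\infty$ for every $m$. An operator $A\in\mathcal L(\mathbf X,\mathcal P)$ is called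 rich if every sequence $h=(h_n)$ in $\mathbb Z^N$ with $|h_n|\to\infty$ has a subsequence $g$ such that $(V_{-g_n}AV_{g_n})$ converges $\mathcal P$-strongly. An operator is called band-dominated if it is the operator-norm limit of a sequence of band operators, i.e. of finite sums $\sum_\alpha a_\alpha V_\alpha$, where $a_\alpha\in l^\infty(\mathbb Z^N,\mathcal L(X))$ acts by entrywise multiplication. Let $\mathcal L^S(\mathbf X,\mathcal P)$ be the set of all rich operators and $\mathcal A_p^S$ the set of all rich band-dominated operators. Then every rich operator is band-dominated, i.e. $\mathcal L^S(\mathbf X,\mathcal P)=\mathcal A_p^S$. -/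

import Mathlib

open Filter Topology
open scoped ENNReal

noncomputable section

/-- The exponent of the `ℓ^q` space in which the sequence space with parameter `p` lives:
`q = p` for `p ∈ [1, ∞]` and `q = ∞` for `p = 0`.  (Only `p ∈ {0} ∪ [1, ∞]` are meant.) -/
def ambientExponent (p : ℝ≥0∞) : ℝ≥0∞ := if 1 ≤ p then p else ∞

instance ambientExponent_fact (p : ℝ≥0∞) : Fact (1 ≤ ambientExponent p) := by
  refine ⟨?_⟩
  unfold ambientExponent
  split_ifs with h
  · exact h
  · exact le_top

/-- The `ℓ^q` space of `X`-valued sequences indexed by `ℤ^N` in which the sequence space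
with parameter `p` lives. -/
abbrev AmbientSpace (N : ℕ) (X : Type*) [NormedAddCommGroup X] (p : ℝ≥0∞) : Type _ :=
  lp (fun _ : Fin N → ℤ => X) (ambientExponent p)

section Spaces

variable (𝕜 : Type*) [RCLike 𝕜] (N : ℕ) (X : Type*) [NormedAddCommGroup X] [NormedSpace 𝕜 X]
  (p : ℝ≥0∞)

/-- The sequences with finite support. -/
def finSuppSeq : Submodule 𝕜 (AmbientSpace N X p) where
  carrier := {x | {i | x i ≠ 0}.Finite}
  zero_mem' := by simp
  add_mem' := by
    intro x y hx hy
    refine (hx.union hy).subset fun i hi => ?_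
    by_contra h
    simp only [Set.mem_union, Set.mem_ofPred_eq, not_or, not_not] at h
    exact hi (by simp [h.1, h.2])
  smul_mem' := by
    intro c x hx
    refine hx.subset fun i hi h => hi ?_
    simp [h]

/-- The space `l^p(ℤ^N, X)`, `p ∈ {0} ∪ [1, ∞]`, as a subspace of the ambient `ℓ^q`: everything
if `p ≠ 0`, and the closure in `l^∞(ℤ^N, X)` of the finitely supported sequences if `p = 0`. -/
def seqSubspace : Submodule 𝕜 (AmbientSpace N X p) :=
  if p = 0 then (finSuppSeq 𝕜 N X p).topologicalClosure else ⊤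

/-- The Banach space `𝐗 = l^p(ℤ^N, X)`, `p ∈ {0} ∪ [1, ∞]`, with its usual norm. -/
def SeqSpace : Type _ := seqSubspace 𝕜 N X p

instance : NormedAddCommGroup (SeqSpace 𝕜 N X p) :=
  inferInstanceAs (NormedAddCommGroup (seqSubspace 𝕜 N X p))

instance : NormedSpace 𝕜 (SeqSpace 𝕜 N X p) :=
  inferInstanceAs (NormedSpace 𝕜 (seqSubspace 𝕜 N X p))

/-- The entries of an element of `𝐗`: `x i` is `x_i`. -/
instance : CoeFun (SeqSpace 𝕜 N X p) fun _ => (Fin N → ℤ) → X := ⟨fun x => x.1⟩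

variable {𝕜 N X p} in
theorem SeqSpace.ext {x y : SeqSpace 𝕜 N X p} (h : ∀ i, x i = y i) : x = y :=
  Subtype.ext (lp.ext (funext h))

variable {𝕜 N X p} in
theorem SeqSpace.norm_def (x : SeqSpace 𝕜 N X p) : ‖x‖ = ‖(x.1 : AmbientSpace N X p)‖ := rfl

variable {𝕜 N X p} in
theorem SeqSpace.add_apply (x y : SeqSpace 𝕜 N X p) (i : Fin N → ℤ) : (x + y) i = x i + y i := rfl

variable {𝕜 N X p} in
theorem SeqSpace.sub_apply (x y : SeqSpace 𝕜 N X p) (i : Fin N → ℤ) : (x - y) i = x i - y i := rfl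

variable {𝕜 N X p} in
theorem SeqSpace.smul_apply (c : 𝕜) (x : SeqSpace 𝕜 N X p) (i : Fin N → ℤ) :
    (c • x) i = c • x i := rfl

end Spaces

section Operators

variable {𝕜 : Type*} [RCLike 𝕜] {N : ℕ} {X : Type*} [NormedAddCommGroup X] [NormedSpace 𝕜 X]
  {p : ℝ≥0∞}

theorem map_seqSubspace (T : AmbientSpace N X p →L[𝕜] AmbientSpace N X p)
    (hT : ∀ x ∈ finSuppSeq 𝕜 N X p, T x ∈ finSuppSeq 𝕜 N X p)
    (x : AmbientSpace N X p) (hx : x ∈ seqSubspace 𝕜 N X p) :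
    T x ∈ seqSubspace 𝕜 N X p := by
  unfold seqSubspace at hx ⊢
  split_ifs at hx ⊢ with h
  · exact map_mem_closure T.continuous hx hT
  · trivial

/-- The operator induced on `𝐗` by an operator on the ambient space that preserves finite
supports. -/
def restrictOp (T : AmbientSpace N X p →L[𝕜] AmbientSpace N X p)
    (hT : ∀ x ∈ finSuppSeq 𝕜 N X p, T x ∈ finSuppSeq 𝕜 N X p) :
    SeqSpace 𝕜 N X p →L[𝕜] SeqSpace 𝕜 N X p :=
  LinearMap.mkContinuous
    { toFun := fun x => ⟨T x.1, map_seqSubspace T hT x.1 x.2⟩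
      map_add' := fun x y => Subtype.ext (T.map_add x.1 y.1)
      map_smul' := fun c x => Subtype.ext (T.map_smul c x.1) }
    ‖T‖ fun x => T.le_opNorm x.1

/-- The multiplication operator `aI`, `(a x)_i = a_i x_i`, of a bounded sequence
`a ∈ l^∞(ℤ^N, L(X))`. -/
def mulOp (p : ℝ≥0∞) (a : lp (fun _ : Fin N → ℤ => X →L[𝕜] X) ∞) :
    SeqSpace 𝕜 N X p →L[𝕜] SeqSpace 𝕜 N X p :=
  restrictOp (lp.mapCLM (ambientExponent p) (fun i => a i) (norm_nonneg a)
      fun i => lp.norm_apply_le_norm ENNReal.top_ne_zero a i) <| by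
    intro x hx
    refine Set.Finite.subset hx fun i hi h => hi ?_
    simp [h]

theorem mulOp_apply (a : lp (fun _ : Fin N → ℤ => X →L[𝕜] X) ∞) (x : SeqSpace 𝕜 N X p)
    (i : Fin N → ℤ) : mulOp p a x i = a i (x i) :=
  rfl

theorem memℓp_shift {q : ℝ≥0∞} (hq : 1 ≤ q) (α : Fin N → ℤ) (x : lp (fun _ : Fin N → ℤ => X) q) :
    Memℓp (fun i => x (i - α)) q := by
  have hx := lp.memℓp x
  rcases q.trichotomy with rfl | rfl | h
  · simp at hq
  · refine memℓp_infty (hx.bddAbove.mono ?_)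
    rintro _ ⟨i, rfl⟩
    exact ⟨i - α, rfl⟩
  · exact memℓp_gen ((Equiv.subRight α).summable_iff.2 (hx.summable h))

theorem norm_shift_le {q : ℝ≥0∞} (hq : 1 ≤ q) (α : Fin N → ℤ) (x : lp (fun _ : Fin N → ℤ => X) q) :
    ‖(⟨fun i => x (i - α), memℓp_shift hq α x⟩ : lp (fun _ : Fin N → ℤ => X) q)‖ ≤ ‖x‖ := by
  rcases q.trichotomy with rfl | rfl | h
  · simp at hq
  · exact lp.norm_le_of_forall_le (lp.norm_nonneg' x)
      fun i => lp.norm_apply_le_norm ENNReal.top_ne_zero x (i - α)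
  · refine lp.norm_le_of_tsum_le h (lp.norm_nonneg' x) ?_
    rw [lp.norm_rpow_eq_tsum h x]
    exact ((Equiv.subRight α).tsum_eq fun i => ‖x i‖ ^ q.toReal).le

/-- The shift on the ambient space. -/
def ambientShift (𝕜 : Type*) [RCLike 𝕜] {N : ℕ} (X : Type*) [NormedAddCommGroup X]
    [NormedSpace 𝕜 X] (p : ℝ≥0∞) (α : Fin N → ℤ) :
    AmbientSpace N X p →L[𝕜] AmbientSpace N X p :=
  LinearMap.mkContinuous
    { toFun := fun x => ⟨fun i => x (i - α), memℓp_shift Fact.out α x⟩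
      map_add' := fun x y => by ext i; rfl
      map_smul' := fun c x => by ext i; rfl }
    1 fun x => by
      rw [one_mul]
      exact norm_shift_le Fact.out α x

/-- The shift operator `V_α`, `(V_α x)_i = x_{i - α}`, on `𝐗`. -/
def shiftOp (𝕜 : Type*) [RCLike 𝕜] {N : ℕ} (X : Type*) [NormedAddCommGroup X]
    [NormedSpace 𝕜 X] (p : ℝ≥0∞) (α : Fin N → ℤ) :
    SeqSpace 𝕜 N X p →L[𝕜] SeqSpace 𝕜 N X p :=
  restrictOp (ambientShift 𝕜 X p α) <| by
    intro x hx
    refine (Set.Finite.image (fun i => i + α) hx).subset fun i hi => ?_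
    exact ⟨i - α, hi, by simp⟩

theorem shiftOp_apply (α : Fin N → ℤ) (x : SeqSpace 𝕜 N X p) (i : Fin N → ℤ) :
    shiftOp 𝕜 X p α x i = x (i - α) :=
  rfl

open Classical in
/-- The characteristic function of `F ⊆ ℤ^N`, as a bounded sequence of scalar multiples of the
identity of `X`. -/
def charSeq (𝕜 : Type*) [RCLike 𝕜] {N : ℕ} (X : Type*) [NormedAddCommGroup X]
    [NormedSpace 𝕜 X] (F : Set (Fin N → ℤ)) : lp (fun _ : Fin N → ℤ => X →L[𝕜] X) ∞ :=
  ⟨fun i => if i ∈ F then ContinuousLinearMap.id 𝕜 X else 0, memℓp_infty <| by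
    refine ⟨‖ContinuousLinearMap.id 𝕜 X‖, ?_⟩
    rintro _ ⟨i, rfl⟩
    dsimp only
    split_ifs
    · exact le_rfl
    · simp⟩

/-- The canonical projection `P_n`: multiplication by the characteristic function of
`{-n, …, n}^N`. -/
def projOp (𝕜 : Type*) [RCLike 𝕜] (N : ℕ) (X : Type*) [NormedAddCommGroup X]
    [NormedSpace 𝕜 X] (p : ℝ≥0∞) (n : ℕ) : SeqSpace 𝕜 N X p →L[𝕜] SeqSpace 𝕜 N X p :=
  mulOp p (charSeq 𝕜 X {i : Fin N → ℤ | ∀ k, |i k| ≤ (n : ℤ)})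

/-- `K` is `𝓟`-compact: `‖(I - P_n) K‖ + ‖K (I - P_n)‖ → 0`. -/
def IsPCompact (K : SeqSpace 𝕜 N X p →L[𝕜] SeqSpace 𝕜 N X p) : Prop :=
  Tendsto (fun n : ℕ =>
      ‖(ContinuousLinearMap.id 𝕜 _ - projOp 𝕜 N X p n) ∘L K‖ +
        ‖K ∘L (ContinuousLinearMap.id 𝕜 _ - projOp 𝕜 N X p n)‖)
    atTop (𝓝 0)

/-- The set `L(𝐗, 𝓟)` of all bounded linear operators `A` on `𝐗` such that `A K` and `K A` are
`𝓟`-compact for every `𝓟`-compact `K`. -/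
def opsLP (𝕜 : Type*) [RCLike 𝕜] (N : ℕ) (X : Type*) [NormedAddCommGroup X]
    [NormedSpace 𝕜 X] (p : ℝ≥0∞) : Set (SeqSpace 𝕜 N X p →L[𝕜] SeqSpace 𝕜 N X p) :=
  {A | ∀ K : SeqSpace 𝕜 N X p →L[𝕜] SeqSpace 𝕜 N X p,
    IsPCompact K → IsPCompact (A ∘L K) ∧ IsPCompact (K ∘L A)}

/-- `𝓟`-strong convergence of a bounded sequence `(A_n)` in `L(𝐗, 𝓟)` to a bounded linear
operator `A`: `‖P_m (A_n - A)‖ + ‖(A_n - A) P_m‖ → 0` for every `m`. -/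
def TendstoPStrongly (A : ℕ → SeqSpace 𝕜 N X p →L[𝕜] SeqSpace 𝕜 N X p)
    (B : SeqSpace 𝕜 N X p →L[𝕜] SeqSpace 𝕜 N X p) : Prop :=
  (∀ n, A n ∈ opsLP 𝕜 N X p) ∧ (∃ C : ℝ, ∀ n, ‖A n‖ ≤ C) ∧
    ∀ m : ℕ, Tendsto (fun n : ℕ =>
        ‖projOp 𝕜 N X p m ∘L (A n - B)‖ + ‖(A n - B) ∘L projOp 𝕜 N X p m‖)
      atTop (𝓝 0)

/-- `A` is a band operator: a finite sum `∑ a_α V_α` with `a_α ∈ l^∞(ℤ^N, L(X))`. -/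
def IsBandOperator (A : SeqSpace 𝕜 N X p →L[𝕜] SeqSpace 𝕜 N X p) : Prop :=
  ∃ (s : Finset (Fin N → ℤ)) (a : (Fin N → ℤ) → lp (fun _ : Fin N → ℤ => X →L[𝕜] X) ∞),
    A = ∑ α ∈ s, mulOp p (a α) ∘L shiftOp 𝕜 X p α

/-- The set `𝓐_p` of all band-dominated operators: operator norm limits of sequences of band
operators. -/
def bandDominated (𝕜 : Type*) [RCLike 𝕜] (N : ℕ) (X : Type*) [NormedAddCommGroup X]
    [NormedSpace 𝕜 X] (p : ℝ≥0∞) : Set (SeqSpace 𝕜 N X p →L[𝕜] SeqSpace 𝕜 N X p) :=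
  {A | ∃ B : ℕ → SeqSpace 𝕜 N X p →L[𝕜] SeqSpace 𝕜 N X p,
    (∀ n, IsBandOperator (B n)) ∧ Tendsto B atTop (𝓝 A)}

/-- The sequence `h` in `ℤ^N` tends to infinity: `|h_n| → ∞`. -/
def TendsToInfinity (h : ℕ → Fin N → ℤ) : Prop :=
  Tendsto (fun n => ‖h n‖) atTop atTop

/-- `B` is the limit operator `A_h`, the `𝓟`-strong limit of `V_{-h_n} A V_{h_n}`. -/
def IsLimitOperator (A : SeqSpace 𝕜 N X p →L[𝕜] SeqSpace 𝕜 N X p) (h : ℕ → Fin N → ℤ)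
    (B : SeqSpace 𝕜 N X p →L[𝕜] SeqSpace 𝕜 N X p) : Prop :=
  TendstoPStrongly (fun n => shiftOp 𝕜 X p (-h n) ∘L A ∘L shiftOp 𝕜 X p (h n)) B

/-- The set `L^S(𝐗, 𝓟)` of all rich operators: those `A ∈ L(𝐗, 𝓟)` for which every sequence
`h` tending to infinity has a subsequence `g` such that the limit operator `A_g` exists. -/
def richOps (𝕜 : Type*) [RCLike 𝕜] (N : ℕ) (X : Type*) [NormedAddCommGroup X]
    [NormedSpace 𝕜 X] (p : ℝ≥0∞) : Set (SeqSpace 𝕜 N X p →L[𝕜] SeqSpace 𝕜 N X p) :=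
  {A | A ∈ opsLP 𝕜 N X p ∧ ∀ h : ℕ → Fin N → ℤ, TendsToInfinity h →
    ∃ φ : ℕ → ℕ, StrictMono φ ∧ ∃ B, IsLimitOperator A (h ∘ φ) B}

/-- The set `𝓐_p^S` of all rich band-dominated operators. -/
def richBandDominated (𝕜 : Type*) [RCLike 𝕜] (N : ℕ) (X : Type*) [NormedAddCommGroup X]
    [NormedSpace 𝕜 X] (p : ℝ≥0∞) : Set (SeqSpace 𝕜 N X p →L[𝕜] SeqSpace 𝕜 N X p) :=
  {A | A ∈ richOps 𝕜 N X p ∧ A ∈ bandDominated 𝕜 N X p}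

end Operators

end

/-! Up to shifts, the `j`-th row of `A` is `P_0 V_{-j} A V_j` and its `j`-th column is `V_{-j} A V_j
P_0`. Since `A` lies in `opsLP`, each row and each column has a tail `I - P_n` whose norm tends to
0. Richness makes the family of all rows, and that of all columns, relatively compact in operator
norm along sequences `j → ∞`, so the decay is uniform in `j` (`exists_forall_norm_row_le`,
`exists_forall_norm_column_le`).

The tail of row or column `j` is what remains of it after removing from `A` the diagonals in a cube.
If the ambient space is `ℓ^∞`, the operator norm is controlled by the rows; if `p = 1`, by the
columns (`norm_sub_bandTrunc_le_of_row`, `norm_sub_bandTrunc_le_of_column`). Hence the band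
truncations of `A` approximate it in norm. For other exponents neither control is available. -/

/-! ### Compactness: from pointwise to uniform decay -/

/-- A Dini-type argument: equi-Lipschitz functionals that tend to 0 at each point do so uniformly on
a relatively compact family. No monotonicity in `n` is needed, because one index `n` is enough. -/
theorem exists_forall_le_of_relatively_compact {N : ℕ} {E : Type*} [SeminormedAddCommGroup E]
    (T : (Fin N → ℤ) → E) (Φ : ℕ → E → ℝ) (c : ℝ)
    (hΦ : ∀ n a b, Φ n a ≤ Φ n b + c * ‖a - b‖)
    (hT : ∀ j, Tendsto (fun n => Φ n (T j)) atTop (𝓝 0))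
    (hc : ∀ h : ℕ → Fin N → ℤ, TendsToInfinity h →
      ∃ φ : ℕ → ℕ, StrictMono φ ∧ ∃ b, Tendsto (fun n => T (h (φ n))) atTop (𝓝 b))
    {ε : ℝ} (hε : 0 < ε) : ∃ n, ∀ j, Φ n (T j) ≤ ε := by
  by_contra! H
  choose h hh using H
  -- Either the bad indices escape to infinity, where `hc` applies, or one of them recurs infinitely
  -- often and contradicts `hT`.
  by_cases hf : ∀ j, {n | h n = j}.Finite
  · have hcof : Tendsto h cofinite cofinite :=
      Tendsto.cofinite_of_finite_preimage_singleton fun j => hf j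
    have hinf : TendsToInfinity h := by
      rw [Nat.cofinite_eq_atTop, ← cocompact_eq_cofinite] at hcof
      exact tendsto_norm_cocompact_atTop.comp hcof
    obtain ⟨φ, hφ, b, hb⟩ := hc h hinf
    have hcau := Metric.cauchySeq_iff'.1 hb.cauchySeq
    have hc0 : 0 < 2 * (|c| + 1) := by positivity
    -- Half of `ε` pays for the Lipschitz error, half for the decay at the frozen point `T (h (φ
    -- k))`; the `+ 1` keeps the denominator positive when `c = 0`.
    obtain ⟨k, hk⟩ := hcau (ε / (2 * (|c| + 1))) (by positivity)
    have hsmall := ((hT (h (φ k))).comp hφ.tendsto_atTop).eventually (gt_mem_nhds (half_pos hε))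
    obtain ⟨n, hn, hkn⟩ := (hsmall.and (eventually_ge_atTop k)).exists
    have h1 := hΦ (φ n) (T (h (φ n))) (T (h (φ k)))
    have h2 := hk n hkn
    rw [dist_eq_norm, lt_div_iff₀ hc0] at h2
    have h3 : c * ‖T (h (φ n)) - T (h (φ k))‖ ≤ (|c| + 1) * ‖T (h (φ n)) - T (h (φ k))‖ := by
      gcongr
      linarith [le_abs_self c]
    have h4 := hh (φ n)
    simp only [Function.comp_apply] at hn
    nlinarith
  · push Not at hf
    obtain ⟨j, hj⟩ := hf
    have hfreq : ∃ᶠ n in atTop, h n = j := Nat.frequently_atTop_iff_infinite.2 hj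
    obtain ⟨n, hn, hn'⟩ := (hfreq.and_eventually ((hT j).eventually (gt_mem_nhds hε))).exists
    have := hh n
    rw [hn] at this
    linarith

/-! ### Coordinates of the sequence space and norm estimates -/

namespace SeqSpace

section

variable {𝕜 : Type*} [RCLike 𝕜] {N : ℕ} {X : Type*} [NormedAddCommGroup X] [NormedSpace 𝕜 X]
  {p : ℝ≥0∞}

theorem norm_apply_le (x : SeqSpace 𝕜 N X p) (i : Fin N → ℤ) : ‖x i‖ ≤ ‖x‖ :=
  lp.norm_apply_le_norm (zero_lt_one.trans_le Fact.out).ne' x.1 i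

theorem norm_le_of_forall_apply_le (hp : ambientExponent p = ∞) (x : SeqSpace 𝕜 N X p) {C : ℝ}
    (hC : 0 ≤ C) (hx : ∀ i, ‖x i‖ ≤ C) : ‖x‖ ≤ C := by
  rw [norm_def]
  -- The exponent occurs in the type of `x`, so it must become a variable before `∞` can be
  -- substituted.
  generalize x.1 = y at hx
  revert y
  unfold AmbientSpace
  generalize ambientExponent p = q at hp
  subst hp
  exact fun y hy => lp.norm_le_of_forall_le hC hy

theorem single_mem_seqSubspace (j : Fin N → ℤ) (x : X) :
    (lp.single (ambientExponent p) j x : AmbientSpace N X p) ∈ seqSubspace 𝕜 N X p := by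
  have h : (lp.single (ambientExponent p) j x : AmbientSpace N X p) ∈ finSuppSeq 𝕜 N X p := by
    refine (Set.finite_singleton j).subset fun i hi => ?_
    by_contra hij
    exact hi (lp.single_apply_ne _ _ _ hij)
  unfold seqSubspace
  split_ifs
  · exact subset_closure h
  · trivial

variable (𝕜 p) in
/-- The sequence with the entry `x` at `j` and zero entries elsewhere. -/
noncomputable def single (j : Fin N → ℤ) : X →L[𝕜] SeqSpace 𝕜 N X p :=
  LinearMap.mkContinuous
    { toFun := fun x => ⟨lp.single (ambientExponent p) j x, single_mem_seqSubspace j x⟩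
      map_add' := fun x y => Subtype.ext (lp.single_add _ _ _ _)
      map_smul' := fun c x => Subtype.ext (lp.single_smul _ _ _ _) }
    1 fun x => by
      rw [one_mul]
      exact (lp.norm_single (E := fun _ : Fin N → ℤ => X) (p := ambientExponent p)
        (zero_lt_one.trans_le Fact.out) j x).le

theorem norm_single_le (j : Fin N → ℤ) : ‖(single 𝕜 p j : X →L[𝕜] SeqSpace 𝕜 N X p)‖ ≤ 1 :=
  LinearMap.mkContinuous_norm_le _ zero_le_one _

theorem single_apply (j : Fin N → ℤ) (x : X) (i : Fin N → ℤ) :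
    single 𝕜 p j x i = if i = j then x else 0 := by
  classical
  refine (Pi.single_apply j x i).trans ?_
  split_ifs <;> rfl

theorem zero_apply (i : Fin N → ℤ) : (0 : SeqSpace 𝕜 N X p) i = 0 := rfl

variable (𝕜 X p) in
/-- The evaluation of the entry with index `i`. -/
noncomputable def eval (i : Fin N → ℤ) : SeqSpace 𝕜 N X p →L[𝕜] X :=
  LinearMap.mkContinuous
    { toFun := fun x => x i
      map_add' := fun x y => add_apply x y i
      map_smul' := fun c x => smul_apply c x i }
    1 fun x => by
      rw [one_mul]
      exact norm_apply_le x i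

theorem norm_eval_le (i : Fin N → ℤ) : ‖eval 𝕜 X p i‖ ≤ 1 :=
  LinearMap.mkContinuous_norm_le _ zero_le_one _

theorem coe_sum {ι : Type*} (s : Finset ι) (f : ι → SeqSpace 𝕜 N X p) (i : Fin N → ℤ) :
    (∑ k ∈ s, f k) i = ∑ k ∈ s, f k i :=
  map_sum (eval 𝕜 X p i) f s

/-- In `ℓ^1` every `x` is the norm-convergent sum of its single-entry parts, and their norms add up
to `‖x‖`. -/
theorem opNorm_le_of_forall_single (hp : p = 1)
    (T : SeqSpace 𝕜 N X p →L[𝕜] SeqSpace 𝕜 N X p) {C : ℝ} (hC : 0 ≤ C)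
    (hT : ∀ j x, ‖T (single 𝕜 p j x)‖ ≤ C * ‖x‖) : ‖T‖ ≤ C := by
  have hq : ambientExponent p = 1 := by simp [ambientExponent, hp]
  refine T.opNorm_le_bound hC fun x => ?_
  have hs : HasSum (fun j => single 𝕜 p j (x j)) x := by
    have hi : IsInducing (seqSubspace 𝕜 N X p).subtype := IsInducing.subtypeVal
    exact (hi.hasSum_iff _ _).1 (lp.hasSum_single (by simp [hq]) x.1)
  have hn : HasSum (fun j => ‖x j‖) ‖x‖ := by
    have := lp.hasSum_norm (by simp [hq]) x.1
    simpa [hq, norm_def] using this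
  rw [← (hs.mapL T).tsum_eq]
  exact tsum_of_norm_bounded (hn.mul_left C) fun j => hT j (x j)

end

end SeqSpace

/-! ### Projections, shifts and `𝓟`-compactness -/

section

open SeqSpace

variable {𝕜 : Type*} [RCLike 𝕜] {N : ℕ} {X : Type*} [NormedAddCommGroup X] [NormedSpace 𝕜 X]
  {p : ℝ≥0∞}

theorem norm_restrictOp_le (T : AmbientSpace N X p →L[𝕜] AmbientSpace N X p)
    (hT : ∀ x ∈ finSuppSeq 𝕜 N X p, T x ∈ finSuppSeq 𝕜 N X p) : ‖restrictOp T hT‖ ≤ ‖T‖ :=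
  LinearMap.mkContinuous_norm_le _ (norm_nonneg _) _

theorem norm_shiftOp_le (α : Fin N → ℤ) : ‖shiftOp 𝕜 X p α‖ ≤ 1 :=
  (norm_restrictOp_le _ _).trans (LinearMap.mkContinuous_norm_le _ zero_le_one _)

theorem norm_mulOp_le (a : lp (fun _ : Fin N → ℤ => X →L[𝕜] X) ∞) : ‖mulOp p a‖ ≤ ‖a‖ :=
  (norm_restrictOp_le _ _).trans (lp.norm_mapCLM_le _ _ _ _)

open Classical in
theorem projOp_apply (n : ℕ) (x : SeqSpace 𝕜 N X p) (i : Fin N → ℤ) :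
    projOp 𝕜 N X p n x i = if ∀ k, |i k| ≤ (n : ℤ) then x i else 0 := by
  rw [projOp, mulOp_apply]
  split_ifs with hi
  · have h : charSeq 𝕜 X {i : Fin N → ℤ | ∀ k, |i k| ≤ (n : ℤ)} i = ContinuousLinearMap.id 𝕜 X :=
      if_pos hi
    rw [h]
    rfl
  · have h : charSeq 𝕜 X {i : Fin N → ℤ | ∀ k, |i k| ≤ (n : ℤ)} i = 0 := if_neg hi
    rw [h]
    rfl

theorem norm_projOp_le (n : ℕ) : ‖projOp 𝕜 N X p n‖ ≤ 1 := by
  refine (norm_mulOp_le _).trans (lp.norm_le_of_forall_le zero_le_one fun i => ?_)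
  simp only [charSeq]
  split_ifs
  · exact ContinuousLinearMap.norm_id_le
  · simp

/-- The complementary projection `I - P_n`. -/
noncomputable abbrev coprojOp (𝕜 : Type*) [RCLike 𝕜] (N : ℕ) (X : Type*) [NormedAddCommGroup X]
    [NormedSpace 𝕜 X] (p : ℝ≥0∞) (n : ℕ) : SeqSpace 𝕜 N X p →L[𝕜] SeqSpace 𝕜 N X p :=
  ContinuousLinearMap.id 𝕜 _ - projOp 𝕜 N X p n

open Classical in
theorem coprojOp_apply (n : ℕ) (x : SeqSpace 𝕜 N X p) (i : Fin N → ℤ) :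
    coprojOp 𝕜 N X p n x i = if ∀ k, |i k| ≤ (n : ℤ) then 0 else x i := by
  have h : coprojOp 𝕜 N X p n x i = x i - projOp 𝕜 N X p n x i := rfl
  rw [h, projOp_apply]
  split_ifs <;> simp

theorem norm_coprojOp_le (n : ℕ) : ‖coprojOp 𝕜 N X p n‖ ≤ 2 := by
  refine (norm_sub_le _ _).trans ?_
  linarith [norm_projOp_le (𝕜 := 𝕜) (N := N) (X := X) (p := p) n,
    ContinuousLinearMap.norm_id_le (𝕜 := 𝕜) (E := SeqSpace 𝕜 N X p)]

theorem isPCompact_iff (K : SeqSpace 𝕜 N X p →L[𝕜] SeqSpace 𝕜 N X p) :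
    IsPCompact K ↔ Tendsto (fun n => ‖coprojOp 𝕜 N X p n ∘L K‖) atTop (𝓝 0) ∧
      Tendsto (fun n => ‖K ∘L coprojOp 𝕜 N X p n‖) atTop (𝓝 0) := by
  refine ⟨fun h => ⟨?_, ?_⟩, fun h => ?_⟩
  · exact squeeze_zero (fun _ => norm_nonneg _)
      (fun _ => le_add_of_nonneg_right (norm_nonneg _)) h
  · exact squeeze_zero (fun _ => norm_nonneg _)
      (fun _ => le_add_of_nonneg_left (norm_nonneg _)) h
  · have := h.1.add h.2
    rwa [add_zero] at this

theorem isPCompact_projOp (m : ℕ) : IsPCompact (projOp 𝕜 N X p m) := by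
  classical
  rw [isPCompact_iff]
  constructor <;>
  · refine tendsto_const_nhds.congr' ?_
    filter_upwards [eventually_ge_atTop m] with n hn
    symm
    rw [norm_eq_zero]
    ext x : 1
    refine SeqSpace.ext fun i => ?_
    simp only [ContinuousLinearMap.comp_apply, projOp_apply, coprojOp_apply]
    have h : (∀ k, |i k| ≤ (m : ℤ)) → ∀ k, |i k| ≤ (n : ℤ) :=
      fun h k => (h k).trans (by exact_mod_cast hn)
    split_ifs <;> first | rfl | tauto

/-- A shift moves supports by a bounded amount `m`, so it sends tails beyond `n + m` into tails
beyond `n`; thus shifts preserve `𝓟`-compactness on either side. -/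
theorem shiftOp_comp_mem_opsLP {A : SeqSpace 𝕜 N X p →L[𝕜] SeqSpace 𝕜 N X p}
    (hA : A ∈ opsLP 𝕜 N X p) (α β : Fin N → ℤ) :
    shiftOp 𝕜 X p α ∘L A ∘L shiftOp 𝕜 X p β ∈ opsLP 𝕜 N X p := by
  have key (γ : Fin N → ℤ) : shiftOp 𝕜 X p γ ∈ opsLP 𝕜 N X p := by
    classical
    obtain ⟨m, hm⟩ : ∃ m : ℕ, ∀ k, |γ k| ≤ m := by
      refine ⟨∑ k, (γ k).natAbs, fun k => ?_⟩
      rw [Int.abs_eq_natAbs]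
      exact_mod_cast Finset.single_le_sum (f := fun k => (γ k).natAbs)
        (fun _ _ => Nat.zero_le _) (Finset.mem_univ k)
    have h1 (n : ℕ) : coprojOp 𝕜 N X p (n + m) ∘L shiftOp 𝕜 X p γ =
        coprojOp 𝕜 N X p (n + m) ∘L shiftOp 𝕜 X p γ ∘L coprojOp 𝕜 N X p n := by
      ext x : 1
      refine SeqSpace.ext fun i => ?_
      simp only [ContinuousLinearMap.comp_apply, coprojOp_apply, shiftOp_apply]
      have h : (∀ k, |(i - γ) k| ≤ (n : ℤ)) → ∀ k, |i k| ≤ ((n + m : ℕ) : ℤ) := by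
        intro h k
        have := h k
        have := hm k
        simp only [Pi.sub_apply] at *
        grind
      split_ifs <;> first | rfl | tauto
    have h2 (n : ℕ) : shiftOp 𝕜 X p γ ∘L coprojOp 𝕜 N X p (n + m) =
        coprojOp 𝕜 N X p n ∘L shiftOp 𝕜 X p γ ∘L coprojOp 𝕜 N X p (n + m) := by
      ext x : 1
      refine SeqSpace.ext fun i => ?_
      simp only [ContinuousLinearMap.comp_apply, coprojOp_apply, shiftOp_apply]
      have h : (∀ k, |i k| ≤ (n : ℤ)) → ∀ k, |(i - γ) k| ≤ ((n + m : ℕ) : ℤ) := by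
        intro h k
        have := h k
        have := hm k
        simp only [Pi.sub_apply] at *
        grind
      split_ifs <;> first | rfl | tauto
    have hV := norm_shiftOp_le (𝕜 := 𝕜) (X := X) (p := p) γ
    have h3 (n : ℕ) : ‖coprojOp 𝕜 N X p n ∘L shiftOp 𝕜 X p γ‖ ≤ 2 :=
      (ContinuousLinearMap.opNorm_comp_le _ _).trans
        ((mul_le_mul (norm_coprojOp_le n) hV (norm_nonneg _) zero_le_two).trans_eq (mul_one 2))
    have h4 (n : ℕ) : ‖shiftOp 𝕜 X p γ ∘L coprojOp 𝕜 N X p n‖ ≤ 2 :=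
      (ContinuousLinearMap.opNorm_comp_le _ _).trans
        ((mul_le_mul hV (norm_coprojOp_le n) (norm_nonneg _) zero_le_one).trans_eq (one_mul 2))
    intro K hK
    obtain ⟨hK1, hK2⟩ := (isPCompact_iff K).1 hK
    refine ⟨(isPCompact_iff _).2 ⟨?_, ?_⟩, (isPCompact_iff _).2 ⟨?_, ?_⟩⟩
    -- Passing to the index `n + m` leaves room for `h1` to insert `I - P_n` next to `K`.
    · rw [← tendsto_add_atTop_iff_nat m]
      refine squeeze_zero (fun _ => norm_nonneg _) (fun n => ?_)
        (by simpa only [mul_zero] using hK1.const_mul 2)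
      rw [← ContinuousLinearMap.comp_assoc, h1, ← ContinuousLinearMap.comp_assoc,
        ContinuousLinearMap.comp_assoc]
      exact (ContinuousLinearMap.opNorm_comp_le _ _).trans
        (mul_le_mul_of_nonneg_right (h3 _) (norm_nonneg _))
    · refine squeeze_zero (fun _ => norm_nonneg _) (fun n => ?_) hK2
      rw [ContinuousLinearMap.comp_assoc]
      exact (ContinuousLinearMap.opNorm_comp_le _ _).trans
        (mul_le_of_le_one_left (norm_nonneg _) hV)
    · refine squeeze_zero (fun _ => norm_nonneg _) (fun n => ?_) hK1
      rw [← ContinuousLinearMap.comp_assoc]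
      exact (ContinuousLinearMap.opNorm_comp_le _ _).trans
        (mul_le_of_le_one_right (norm_nonneg _) hV)
    · rw [← tendsto_add_atTop_iff_nat m]
      refine squeeze_zero (fun _ => norm_nonneg _) (fun n => ?_)
        (by simpa only [zero_mul] using hK2.mul_const 2)
      rw [ContinuousLinearMap.comp_assoc, h2, ← ContinuousLinearMap.comp_assoc K]
      exact (ContinuousLinearMap.opNorm_comp_le _ _).trans
        (mul_le_mul_of_nonneg_left (h4 _) (norm_nonneg _))
  intro K hK
  refine ⟨?_, ?_⟩
  · have := (key α _ (hA _ (key β K hK).1).1).1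
    simpa only [ContinuousLinearMap.comp_assoc] using this
  · have := (key β _ (hA _ (key α K hK).2).2).2
    simpa only [ContinuousLinearMap.comp_assoc] using this

/-- The conjugate `V_{-j} A V_j`. -/
noncomputable abbrev shiftConj (A : SeqSpace 𝕜 N X p →L[𝕜] SeqSpace 𝕜 N X p) (j : Fin N → ℤ) :
    SeqSpace 𝕜 N X p →L[𝕜] SeqSpace 𝕜 N X p :=
  shiftOp 𝕜 X p (-j) ∘L A ∘L shiftOp 𝕜 X p j

/-! ### Uniform decay of rows and columns -/

/-- Of `𝓟`-strong convergence only the term with `P_0` on the left is used: it is norm convergence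
of the rows. The Lipschitz constant 2 bounds `‖I - P_n‖`. -/
theorem exists_forall_norm_row_le {A : SeqSpace 𝕜 N X p →L[𝕜] SeqSpace 𝕜 N X p}
    (hA : A ∈ richOps 𝕜 N X p) {ε : ℝ} (hε : 0 < ε) :
    ∃ n, ∀ j, ‖(projOp 𝕜 N X p 0 ∘L shiftConj A j) ∘L coprojOp 𝕜 N X p n‖ ≤ ε := by
  refine exists_forall_le_of_relatively_compact (fun j => projOp 𝕜 N X p 0 ∘L shiftConj A j)
    (fun n T => ‖T ∘L coprojOp 𝕜 N X p n‖) 2 (fun n a b => ?_) (fun j => ?_) (fun h hh => ?_) hε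
  · have h1 : a ∘L coprojOp 𝕜 N X p n =
        b ∘L coprojOp 𝕜 N X p n + (a - b) ∘L coprojOp 𝕜 N X p n := by
      rw [ContinuousLinearMap.sub_comp]; abel
    rw [h1, mul_comm]
    exact (norm_add_le _ _).trans (add_le_add_right ((ContinuousLinearMap.opNorm_comp_le _ _).trans
      (mul_le_mul_of_nonneg_left (norm_coprojOp_le n) (norm_nonneg _))) _)
  · exact ((isPCompact_iff _).1
      (shiftOp_comp_mem_opsLP hA.1 _ _ _ (isPCompact_projOp 0)).2).2
  · obtain ⟨φ, hφ, B, -, -, hB⟩ := hA.2 h hh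
    refine ⟨φ, hφ, projOp 𝕜 N X p 0 ∘L B, ?_⟩
    rw [tendsto_iff_norm_sub_tendsto_zero]
    refine squeeze_zero (fun _ => norm_nonneg _) (fun n => ?_) (hB 0)
    rw [← ContinuousLinearMap.comp_sub]
    exact le_add_of_nonneg_right (norm_nonneg _)

theorem exists_forall_norm_column_le {A : SeqSpace 𝕜 N X p →L[𝕜] SeqSpace 𝕜 N X p}
    (hA : A ∈ richOps 𝕜 N X p) {ε : ℝ} (hε : 0 < ε) :
    ∃ n, ∀ j, ‖coprojOp 𝕜 N X p n ∘L (shiftConj A j ∘L projOp 𝕜 N X p 0)‖ ≤ ε := by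
  refine exists_forall_le_of_relatively_compact (fun j => shiftConj A j ∘L projOp 𝕜 N X p 0)
    (fun n T => ‖coprojOp 𝕜 N X p n ∘L T‖) 2 (fun n a b => ?_) (fun j => ?_) (fun h hh => ?_) hε
  · have h1 : coprojOp 𝕜 N X p n ∘L a =
        coprojOp 𝕜 N X p n ∘L b + coprojOp 𝕜 N X p n ∘L (a - b) := by
      rw [ContinuousLinearMap.comp_sub]; abel
    rw [h1]
    exact (norm_add_le _ _).trans (add_le_add_right ((ContinuousLinearMap.opNorm_comp_le _ _).trans
      (mul_le_mul_of_nonneg_right (norm_coprojOp_le n) (norm_nonneg _))) _)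
  · exact ((isPCompact_iff _).1
      (shiftOp_comp_mem_opsLP hA.1 _ _ _ (isPCompact_projOp 0)).1).1
  · obtain ⟨φ, hφ, B, -, -, hB⟩ := hA.2 h hh
    refine ⟨φ, hφ, B ∘L projOp 𝕜 N X p 0, ?_⟩
    rw [tendsto_iff_norm_sub_tendsto_zero]
    refine squeeze_zero (fun _ => norm_nonneg _) (fun n => ?_) (hB 0)
    rw [← ContinuousLinearMap.sub_comp]
    exact le_add_of_nonneg_left (norm_nonneg _)

/-! ### Band truncation and its error -/

/-- The `α`-th diagonal of the matrix of `A`. -/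
noncomputable def diagSeq (A : SeqSpace 𝕜 N X p →L[𝕜] SeqSpace 𝕜 N X p) (α : Fin N → ℤ) :
    lp (fun _ : Fin N → ℤ => X →L[𝕜] X) ∞ :=
  ⟨fun i => eval 𝕜 X p i ∘L A ∘L single 𝕜 p (i - α), memℓp_infty <| by
    refine ⟨‖A‖, ?_⟩
    rintro _ ⟨i, rfl⟩
    refine (ContinuousLinearMap.opNorm_comp_le _ _).trans
      ((mul_le_of_le_one_left (norm_nonneg _) (norm_eval_le i)).trans ?_)
    exact (ContinuousLinearMap.opNorm_comp_le _ _).trans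
      (mul_le_of_le_one_right (norm_nonneg _) (norm_single_le _))⟩

/-- The cube `{-n, …, n}^N`. -/
noncomputable def cube (N n : ℕ) : Finset (Fin N → ℤ) := Finset.Icc (fun _ => -(n : ℤ)) fun _ => n

theorem mem_cube {n : ℕ} {i : Fin N → ℤ} : i ∈ cube N n ↔ ∀ k, |i k| ≤ (n : ℤ) := by
  simp [cube, Pi.le_def, abs_le, forall_and]

/-- The band truncation of `A`: the diagonals with index in `{-n, …, n}^N`. -/
noncomputable def bandTrunc (A : SeqSpace 𝕜 N X p →L[𝕜] SeqSpace 𝕜 N X p) (n : ℕ) :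
    SeqSpace 𝕜 N X p →L[𝕜] SeqSpace 𝕜 N X p :=
  ∑ α ∈ cube N n, mulOp p (diagSeq A α) ∘L shiftOp 𝕜 X p α

theorem bandTrunc_apply (A : SeqSpace 𝕜 N X p →L[𝕜] SeqSpace 𝕜 N X p) (n : ℕ)
    (x : SeqSpace 𝕜 N X p) (i : Fin N → ℤ) :
    bandTrunc A n x i = ∑ α ∈ cube N n, A (single 𝕜 p (i - α) (x (i - α))) i := by
  unfold bandTrunc
  rw [_root_.sum_apply, coe_sum]
  rfl

theorem conj_projOp_apply (n : ℕ) (x : SeqSpace 𝕜 N X p) (i : Fin N → ℤ) :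
    shiftOp 𝕜 X p i (projOp 𝕜 N X p n (shiftOp 𝕜 X p (-i) x)) =
      ∑ α ∈ cube N n, single 𝕜 p (i - α) (x (i - α)) := by
  classical
  refine SeqSpace.ext fun l => ?_
  rw [coe_sum]
  simp only [shiftOp_apply, projOp_apply, single_apply, ← mem_cube]
  have h (α : Fin N → ℤ) : l = i - α ↔ α = i - l := by
    constructor <;> (rintro rfl; simp)
  simp only [h]
  rw [Finset.sum_ite_eq']
  have h' : i - l ∈ cube N n ↔ l - i ∈ cube N n := by
    simp only [mem_cube, Pi.sub_apply, abs_sub_comm]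
  simp [h']

/-- For `p = ∞` the matrix need not determine `A`. This does no harm: truncation removes only the
action of `A` on finitely many entries per row, and the tail bound covers all the rest, including
what no matrix entry sees. -/
theorem norm_sub_bandTrunc_le_of_row (hp : ambientExponent p = ∞)
    (A : SeqSpace 𝕜 N X p →L[𝕜] SeqSpace 𝕜 N X p) (n : ℕ) {ε : ℝ} (hε : 0 ≤ ε)
    (h : ∀ j, ‖(projOp 𝕜 N X p 0 ∘L shiftConj A j) ∘L coprojOp 𝕜 N X p n‖ ≤ ε) :
    ‖A - bandTrunc A n‖ ≤ ε := by
  classical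
  refine ContinuousLinearMap.opNorm_le_bound _ hε fun x =>
    norm_le_of_forall_apply_le hp _ (by positivity) fun i => ?_
  have hx : shiftOp 𝕜 X p i (shiftOp 𝕜 X p (-i) x) = x := by
    refine SeqSpace.ext fun l => ?_
    simp only [shiftOp_apply]
    rw [sub_neg_eq_add, sub_add_cancel]
  have key : (A - bandTrunc A n) x i =
      ((projOp 𝕜 N X p 0 ∘L shiftConj A i) ∘L coprojOp 𝕜 N X p n) (shiftOp 𝕜 X p (-i) x) 0 := by
    simp only [ContinuousLinearMap.comp_apply, coprojOp, _root_.sub_apply, map_sub,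
      ContinuousLinearMap.id_apply, hx, conj_projOp_apply]
    simp [SeqSpace.sub_apply, bandTrunc_apply, map_sum, coe_sum,
      projOp_apply, shiftOp_apply]
  rw [key]
  refine (norm_apply_le _ _).trans ((ContinuousLinearMap.le_opNorm _ _).trans ?_)
  exact mul_le_mul (h i) ((ContinuousLinearMap.le_opNorm _ _).trans
    (mul_le_of_le_one_left (norm_nonneg _) (norm_shiftOp_le _))) (norm_nonneg _) hε

theorem norm_sub_bandTrunc_le_of_column (hp : p = 1)
    (A : SeqSpace 𝕜 N X p →L[𝕜] SeqSpace 𝕜 N X p) (n : ℕ) {ε : ℝ} (hε : 0 ≤ ε)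
    (h : ∀ j, ‖coprojOp 𝕜 N X p n ∘L (shiftConj A j ∘L projOp 𝕜 N X p 0)‖ ≤ ε) :
    ‖A - bandTrunc A n‖ ≤ ε := by
  classical
  refine opNorm_le_of_forall_single hp _ hε fun j x => ?_
  have hx : shiftOp 𝕜 X p j (projOp 𝕜 N X p 0 (single 𝕜 p 0 x)) = single 𝕜 p j x := by
    refine SeqSpace.ext fun l => ?_
    simp only [shiftOp_apply, projOp_apply, single_apply, sub_eq_zero]
    by_cases hl : l = j <;> simp [hl]
  have key : (A - bandTrunc A n) (single 𝕜 p j x) = shiftOp 𝕜 X p j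
      ((coprojOp 𝕜 N X p n ∘L (shiftConj A j ∘L projOp 𝕜 N X p 0)) (single 𝕜 p 0 x)) := by
    refine SeqSpace.ext fun i => ?_
    simp only [ContinuousLinearMap.comp_apply, hx, shiftOp_apply j, coprojOp_apply, ← mem_cube]
    simp only [_root_.sub_apply, SeqSpace.sub_apply, bandTrunc_apply, shiftOp_apply]
    -- Column `j` meets row `i` on the single diagonal `i - j`, so the truncation keeps this entry
    -- exactly when `i - j` lies in the cube.
    have hs (α : Fin N → ℤ) : A (single 𝕜 p (i - α) (single 𝕜 p j x (i - α))) i =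
        if α = i - j then A (single 𝕜 p j x) i else 0 := by
      have hα : i - α = j ↔ α = i - j := by
        constructor <;> (rintro rfl; simp)
      rw [single_apply]
      by_cases hc : α = i - j
      · rw [if_pos (hα.2 hc), if_pos hc, hα.2 hc]
      · rw [if_neg fun h' => hc (hα.1 h'), if_neg hc, map_zero, map_zero, SeqSpace.zero_apply]
    simp only [hs]
    rw [Finset.sum_ite_eq']
    have hi : i - j - -j = i := by abel
    rw [hi]
    split_ifs <;> simp
  rw [key]
  refine (ContinuousLinearMap.le_opNorm _ _).trans
    ((mul_le_of_le_one_left (norm_nonneg _) (norm_shiftOp_le _)).trans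
      ((ContinuousLinearMap.le_opNorm _ _).trans ?_))
  exact mul_le_mul (h j) ((ContinuousLinearMap.le_opNorm _ _).trans
    (mul_le_of_le_one_left (norm_nonneg _) (norm_single_le _))) (norm_nonneg _) hε

theorem mem_bandDominated_of_mem_richOps (hp : p = 0 ∨ p = 1 ∨ p = ∞)
    {A : SeqSpace 𝕜 N X p →L[𝕜] SeqSpace 𝕜 N X p} (hA : A ∈ richOps 𝕜 N X p) :
    A ∈ bandDominated 𝕜 N X p := by
  have key (ε : ℝ) (hε : 0 < ε) : ∃ n, ‖A - bandTrunc A n‖ ≤ ε := by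
    rcases eq_or_ne p 1 with h1 | h1
    · obtain ⟨n, hn⟩ := exists_forall_norm_column_le hA hε
      exact ⟨n, norm_sub_bandTrunc_le_of_column h1 A n hε.le hn⟩
    · have hq : ambientExponent p = ∞ := by
        rcases hp with rfl | rfl | rfl
        · simp [ambientExponent]
        · exact absurd rfl h1
        · simp [ambientExponent]
      obtain ⟨n, hn⟩ := exists_forall_norm_row_le hA hε
      exact ⟨n, norm_sub_bandTrunc_le_of_row hq A n hε.le hn⟩
  choose n hn using fun k : ℕ => key (1 / ((k : ℝ) + 1)) (by positivity)
  refine ⟨fun k => bandTrunc A (n k), fun k => ⟨_, _, rfl⟩, ?_⟩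
  rw [tendsto_iff_norm_sub_tendsto_zero]
  refine squeeze_zero (fun _ => norm_nonneg _) (fun k => ?_) tendsto_one_div_add_atTop_nhds_zero_nat
  rw [norm_sub_rev]
  exact hn k

end

theorem theorem15 {𝕜 : Type*} [RCLike 𝕜] (N : ℕ) (X : Type*) [NormedAddCommGroup X]
    [NormedSpace 𝕜 X] [CompleteSpace X] (p : ℝ≥0∞) (hp : p = 0 ∨ p = 1 ∨ p = ∞) :
    (∀ A ∈ richOps 𝕜 N X p, A ∈ bandDominated 𝕜 N X p) ∧
      richOps 𝕜 N X p = richBandDominated 𝕜 N X p :=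
  ⟨fun _ hA => mem_bandDominated_of_mem_richOps hp hA,
    Set.Subset.antisymm (fun _ hA => ⟨hA, mem_bandDominated_of_mem_richOps hp hA⟩)
      fun _ hA => hA.1⟩
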